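/- Let $n\ge 2$ and let $f:\mathbb R^n\setminus\{0\}\to\mathbb C$ be a smooth function with bounded support. Let $(\mathbb R^n)^*$ be the dual space of $\mathbb R^n$, with pairing $\langle\xi,x\rangle$. For $\xi\in(\mathbb R^n)^*\setminus\{0\}$ put $$Mf(\xi)=\int_{\langle\xi,x\rangle=1} f(x)\,d\mu_\xi,$$ where $d\mu_\xi$ is the measure on the hyperplanes $\langle\xi,x\rangle=t$ normalized by $d\mu_\xi\,dt=dx$ (that is, $\|\xi\|^{-1}$ times the $(n-1)$-dimensional Euclidean Lebesgue measure). Let $\operatorname{supp}(f)\subset\mathbb R^n\setminus\{0\}$ and $\operatorname{supp}(Mf)\subset(\mathbb R^n)^*\setminus\{0\}$ be the (relatively closed) supports. Let $\widehat C_f$ be the convex hull of $\operatorname{supp}(f)\cup\{0\}$, and for a convex set $C\subset\mathbb R^n$ containing $0$ let $$C^*=\{\xi\in(\mathbb R^n)^* : \text{the hyperplane } \langle\xi,x\rangle=1 \text{ is disjoint from } C\}=\{\xi : \langle\xi,x\rangle<1 \text{ for all } x\in C\}.$$ Then the connected component containing $0$ of $(\mathbb R^n)^*\setminus\operatorname{supp}(Mf)$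 is equal to $(\widehat C_f)^*$. In particular, this component is convex. -/

import Mathlib

open MeasureTheory
open scoped ContDiff ENNReal

noncomputable section

/-- Euclidean space `ℝⁿ`. -/
abbrev RSpace (n : ℕ) : Type := EuclideanSpace ℝ (Fin n)

/-- The dual space `(ℝⁿ)*` of linear functionals `ξ`, with pairing `⟨ξ, x⟩ = ξ x`. -/
abbrev RDual (n : ℕ) : Type := StrongDual ℝ (RSpace n)

/-- `f` is a complex-valued smooth function on `ℝⁿ ∖ {0}` with bounded support. A function on
`ℝⁿ ∖ {0}` is represented by a function on `ℝⁿ` whose value at `0` is irrelevant. -/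
structure IsSmoothBoundedSupport {n : ℕ} (f : RSpace n → ℂ) : Prop where
  smooth : ContDiffOn ℝ ∞ f {0}ᶜ
  bounded : Bornology.IsBounded {x : RSpace n | x ≠ 0 ∧ f x ≠ 0}

/-- The support, as a relatively closed subset of `V ∖ {0}`, of the restriction of `g` to
`V ∖ {0}`. It does not depend on `g 0`. -/
def puncturedSupport {V : Type*} [TopologicalSpace V] [Zero V] (g : V → ℂ) : Set V :=
  closure {x : V | x ≠ 0 ∧ g x ≠ 0} \ {0}

/-- The point of the hyperplane `⟨ξ, x⟩ = t` closest to the origin (for `ξ ≠ 0`). -/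
def hyperplaneBase {n : ℕ} (ξ : RDual n) (t : ℝ) : RSpace n :=
  (t / ‖ξ‖ ^ 2) • (InnerProductSpace.toDual ℝ (RSpace n)).symm ξ

/-- The measure `dμ_ξ` on the hyperplane `⟨ξ, x⟩ = t` (for `ξ ≠ 0`), normalized by
`dμ_ξ dt = dx`: the Euclidean `(n-1)`-dimensional Lebesgue measure of the hyperplane, which is
a translate of `ker ξ`, divided by `‖ξ‖`. -/
def hyperplaneMeasure {n : ℕ} (ξ : RDual n) (t : ℝ) : Measure (RSpace n) :=
  ENNReal.ofReal ‖ξ‖⁻¹ •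
    (volume : Measure ξ.ker).map (fun y : ξ.ker => hyperplaneBase ξ t + (y : RSpace n))

/-- The Radon transform `M f (ξ) = ∫_{⟨ξ, x⟩ = 1} f(x) dμ_ξ` (meaningful for `ξ ≠ 0`). -/
def radonM {n : ℕ} (f : RSpace n → ℂ) (ξ : RDual n) : ℂ :=
  ∫ x, f x ∂(hyperplaneMeasure ξ 1)

/-- The dual `C*` of a convex set `C ⊆ ℝⁿ` containing `0`: all `ξ` such that the hyperplane
`⟨ξ, x⟩ = 1` is disjoint from `C`. -/
def polarDual {n : ℕ} (C : Set (RSpace n)) : Set (RDual n) :=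
  {ξ | Disjoint {x : RSpace n | ξ x = 1} C}

/-- For convex `C` containing `0`, `C* = {ξ | ⟨ξ, x⟩ < 1 for all x ∈ C}`. -/
theorem polarDual_eq {n : ℕ} {C : Set (RSpace n)} (hC : Convex ℝ C) (h0 : (0 : RSpace n) ∈ C) :
    polarDual C = {ξ : RDual n | ∀ x ∈ C, ξ x < 1} := by
  ext ξ
  simp only [polarDual, Set.mem_ofPred_eq, Set.disjoint_left]
  constructor
  · intro h x hx
    by_contra! hlt
    have hpos : 0 < ξ x := by linarith
    refine h (a := (ξ x)⁻¹ • x) ?_ ?_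
    · simp [hpos.ne']
    · exact hC.smul_mem_of_zero_mem h0 hx ⟨by positivity, inv_le_one_of_one_le₀ hlt⟩
  · intro h x hx hxC
    exact (h x hxC).ne hx

/-- The measures `hyperplaneMeasure ξ t` are concentrated on the hyperplanes `⟨ξ, x⟩ = t`. -/
theorem hyperplaneMeasure_compl {n : ℕ} {ξ : RDual n} (hξ : ξ ≠ 0) (t : ℝ) :
    hyperplaneMeasure ξ t {x | ξ x = t}ᶜ = 0 := by
  have hm : MeasurableSet {x : RSpace n | ξ x = t} :=
    (isClosed_eq ξ.continuous continuous_const).measurableSet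
  have hv : ξ ((InnerProductSpace.toDual ℝ (RSpace n)).symm ξ) = ‖ξ‖ ^ 2 := by
    rw [← InnerProductSpace.toDual_symm_apply (𝕜 := ℝ), real_inner_self_eq_norm_sq]
    simp
  have hn : ‖ξ‖ ^ 2 ≠ 0 := by simpa using hξ
  rw [hyperplaneMeasure, Measure.smul_apply, Measure.map_apply (by fun_prop) hm.compl]
  have : (fun y : ξ.ker => hyperplaneBase ξ t + (y : RSpace n)) ⁻¹' {x | ξ x = t}ᶜ = ∅ := by
    ext y
    simp [hyperplaneBase, hv, hn]
  simp [this]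

/-- The normalization `dμ_ξ dt = dx`. -/
theorem lintegral_hyperplaneMeasure {n : ℕ} {ξ : RDual n} (hξ : ξ ≠ 0)
    {g : RSpace n → ℝ≥0∞} (hg : Measurable g) :
    ∫⁻ t : ℝ, ∫⁻ x, g x ∂(hyperplaneMeasure ξ t) = ∫⁻ x, g x := by
  set v : RSpace n := (InnerProductSpace.toDual ℝ (RSpace n)).symm ξ with hvdef
  have hr : 0 < ‖ξ‖ := norm_pos_iff.mpr hξ
  have hvn : ‖v‖ = ‖ξ‖ := by simp [hvdef]
  have hin : ∀ x, inner ℝ v x = ξ x := fun x => by simp [hvdef]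
  have hv : ξ v = ‖ξ‖ ^ 2 := by rw [← hin, real_inner_self_eq_norm_sq, hvn]
  let u : RSpace n := ‖ξ‖⁻¹ • v
  have hu : ξ u = ‖ξ‖ := by simp only [u, map_smul, hv, smul_eq_mul]; field_simp
  have hun : ‖u‖ = 1 := by simp [u, norm_smul, hvn, hr.ne']
  let l : WithLp 2 (ξ.ker × ℝ) →ₗ[ℝ] RSpace n :=
    { toFun := fun p => (p.fst : RSpace n) + p.snd • u
      map_add' := fun p q => by simp [add_smul]; abel
      map_smul' := fun c p => by simp [smul_smul] }
  have hl : ∀ p, ‖l p‖ = ‖p‖ := by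
    intro p
    have hp : ξ (p.fst : RSpace n) = 0 := p.fst.2
    have ho : inner ℝ (p.fst : RSpace n) (p.snd • u) = 0 := by
      rw [real_inner_comm, inner_smul_left, inner_smul_left, hin, hp]; simp
    have h1 := norm_add_sq_eq_norm_sq_add_norm_sq_of_inner_eq_zero _ _ ho
    rw [← sq_eq_sq₀ (by positivity) (by positivity), WithLp.prod_norm_sq_eq_of_L2]
    simp only [norm_smul, hun, mul_one] at h1
    have h2 : l p = (p.fst : RSpace n) + p.snd • u := rfl
    rw [h2, sq, h1, Real.norm_eq_abs, Submodule.coe_norm]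
    ring
  let L : WithLp 2 (ξ.ker × ℝ) →ₗᵢ[ℝ] RSpace n := ⟨l, hl⟩
  have hs : Function.Surjective L := by
    intro x
    refine ⟨WithLp.toLp 2 (⟨x - (ξ x / ‖ξ‖) • u, ?_⟩, ξ x / ‖ξ‖), ?_⟩
    · simp [hu, hr.ne']
    · change x - (ξ x / ‖ξ‖) • u + (ξ x / ‖ξ‖) • u = x
      simp
  let e := LinearIsometryEquiv.ofSurjective L hs
  have hmp := e.measurePreserving.comp (WithLp.volume_preserving_toLp ξ.ker ℝ)
  have hfun : (e ∘ WithLp.toLp 2 : ξ.ker × ℝ → RSpace n) = fun p => (p.1 : RSpace n) + p.2 • u := by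
    ext1 p; rfl
  rw [hfun] at hmp
  rw [← hmp.lintegral_comp hg, Measure.volume_eq_prod,
    lintegral_prod_symm (fun p : ξ.ker × ℝ => g ((p.1 : RSpace n) + p.2 • u))
      (hg.comp hmp.measurable).aemeasurable]
  have hmeas : Measurable fun s : ℝ => ∫⁻ y : ξ.ker, g ((y : RSpace n) + s • u) :=
    Measurable.lintegral_prod_left' (f := fun p : ξ.ker × ℝ => g ((p.1 : RSpace n) + p.2 • u))
      (hg.comp hmp.measurable)
  have hinner : ∀ t : ℝ, ∫⁻ x, g x ∂(hyperplaneMeasure ξ t) =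
      ENNReal.ofReal ‖ξ‖⁻¹ * ∫⁻ y : ξ.ker, g ((y : RSpace n) + (‖ξ‖⁻¹ * t) • u) := by
    intro t
    rw [hyperplaneMeasure, lintegral_smul_measure, lintegral_map hg (by fun_prop), smul_eq_mul]
    congr 2
    ext1 y
    congr 1
    rw [add_comm]
    congr 1
    simp only [hyperplaneBase, u, smul_smul, ← hvdef]
    congr 1
    field_simp
  simp_rw [hinner]
  generalize hG : (fun s : ℝ => ∫⁻ y : ξ.ker, g ((y : RSpace n) + s • u)) = G at hmeas
  have hG' : ∀ s : ℝ, ∫⁻ y : ξ.ker, g ((y : RSpace n) + s • u) = G s := fun s => by rw [← hG]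
  simp_rw [hG']
  rw [lintegral_const_mul _ (by fun_prop), ← lintegral_map hmeas (measurable_const_mul _),
    Real.map_volume_mul_left (by positivity), lintegral_smul_measure, smul_eq_mul, ← mul_assoc,
    ← ENNReal.ofReal_mul (by positivity)]
  simp [abs_of_pos hr, hr.ne']

end

open Set Filter Topology

/-! ### Vanishing integrals over graphs and moments. -/

section GraphMoments

/-! Let `V` be the set of `ξ` with `ξ < 1` on `supp f ∪ {0}`. It is open, convex, contains `0`, and
`Mf` vanishes on it away from `0`, so it lies in the component. It remains to see that `V` is closed
in the complement of `supp (Mf)`. At a limit point `ξ` of `V` there, `f` lives in `ξ ≤ 1` and `Mf =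
0` near `ξ`. The local support theorem `exists_forall_eq_zero_of_radonM_eventually_eq_zero` then
keeps `supp f` off the hyperplane `ξ = 1`, hence `ξ ∈ V`.

For the local theorem, write nearby hyperplanes as graphs `t = b + a y` over `ker ξ`. Varying the
slope `a` in a direction `l` has the same effect as inserting the weight `l` and varying `b`. So the
integral weighted by `l` is constant in `b`, and it is zero because some parallel graph misses the
support. Iterating, all polynomial moments of each slice vanish, and by Stone–Weierstrass the slice
is zero (`eq_zero_of_integral_graph_eq_zero`). -/

theorem eq_zero_of_notMem_fst_image_tsupport {K : Type*} [TopologicalSpace K] {h : K × ℝ → ℂ}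
    {y : K} (hy : y ∉ Prod.fst '' tsupport h) (t : ℝ) : h (y, t) = 0 := by
  by_contra hne
  exact hy ⟨(y, t), subset_tsupport _ hne, rfl⟩

theorem HasCompactSupport.smul_comp_graph {K : Type*} [TopologicalSpace K] [T2Space K]
    {h : K × ℝ → ℂ} (hs : HasCompactSupport h) (w α : K → ℝ) :
    HasCompactSupport fun y => w y • h (y, α y) :=
  HasCompactSupport.intro (hs.isCompact.image continuous_fst) fun y hy => by
    rw [eq_zero_of_notMem_fst_image_tsupport hy, smul_zero]

variable {K : Type*} [NormedAddCommGroup K] [MeasurableSpace K] [BorelSpace K] {μ : Measure K}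
  [IsFiniteMeasureOnCompacts μ]

theorem integrable_smul_graph {h : K × ℝ → ℂ} (hc : Continuous h) (hs : HasCompactSupport h)
    {w α : K → ℝ} (hw : Continuous w) (hα : Continuous α) :
    Integrable (fun y => w y • h (y, α y)) μ :=
  Continuous.integrable_of_hasCompactSupport (by fun_prop) (hs.smul_comp_graph w α)

variable [NormedSpace ℝ K]

/-- Used twice: `β = 1` varies the height of a graph, `β = l` varies its slope. -/
theorem hasDerivAt_integral_smul_graph {h : K × ℝ → ℂ} (hd : ContDiff ℝ 1 h)
    (hs : HasCompactSupport h) {w α β : K → ℝ} (hw : Continuous w) (hα : Continuous α)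
    (hβ : Continuous β) (s₀ : ℝ) :
    HasDerivAt (fun s : ℝ => ∫ y, w y • h (y, α y + s * β y) ∂μ)
      (∫ y, (w y * β y) • fderiv ℝ h (y, α y + s₀ * β y) (0, 1) ∂μ) s₀ := by
  have hc : Continuous h := hd.continuous
  have hc' : Continuous fun p => fderiv ℝ h p (0, 1) :=
    (hd.continuous_fderiv one_ne_zero).clm_apply continuous_const
  have hs' : HasCompactSupport fun p => fderiv ℝ h p (0, 1) := hs.fderiv_apply ℝ (0, 1)
  obtain ⟨C, hC⟩ := hs'.exists_bound_of_continuous hc'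
  have hC0 : 0 ≤ C := (norm_nonneg _).trans (hC 0)
  -- The projection of the support to `K` does not depend on `s`, so it carries an integrable bound
  -- uniform in `s`.
  have hS : IsCompact (Prod.fst '' tsupport fun p => fderiv ℝ h p (0, 1)) :=
    hs'.isCompact.image continuous_fst
  set S := Prod.fst '' tsupport fun p => fderiv ℝ h p (0, 1)
  refine (hasDerivAt_integral_of_dominated_loc_of_deriv_le (μ := μ)
    (F := fun s y => w y • h (y, α y + s * β y))
    (F' := fun s y => (w y * β y) • fderiv ℝ h (y, α y + s * β y) (0, 1))
    (bound := S.indicator fun y => |w y * β y| * C) univ_mem ?_ ?_ ?_ ?_ ?_ ?_).2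
  · exact .of_forall fun s => (by fun_prop : Continuous _).aestronglyMeasurable
  · exact integrable_smul_graph hc hs hw (by fun_prop)
  · exact ((hw.mul hβ).smul (hc'.comp (by fun_prop))).aestronglyMeasurable
  · refine .of_forall fun y s _ => ?_
    by_cases hy : y ∈ S
    · rw [indicator_of_mem hy, norm_smul, Real.norm_eq_abs]
      exact mul_le_mul_of_nonneg_left (hC _) (abs_nonneg _)
    · rw [indicator_of_notMem hy,
        eq_zero_of_notMem_fst_image_tsupport (h := fun p => fderiv ℝ h p (0, 1)) hy,
        smul_zero, norm_zero]
  · rw [integrable_indicator_iff hS.measurableSet]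
    exact (by fun_prop : Continuous _).continuousOn.integrableOn_compact hS
  · refine .of_forall fun y s _ => ?_
    have h1 : HasDerivAt (fun s : ℝ => (y, α y + s * β y)) ((0 : K), β y) s := by
      refine (hasDerivAt_const s y).prodMk ?_
      simpa using ((hasDerivAt_id s).mul_const (β y)).const_add (α y)
    have h2 := ((hd.differentiable one_ne_zero _).hasFDerivAt.comp_hasDerivAt s h1).const_smul (w y)
    have h3 : ((0 : K), β y) = β y • ((0 : K), (1 : ℝ)) := by simp
    rw [h3, map_smul, smul_smul] at h2
    exact h2

/-- Differentiating in the slope of the graphs multiplies the weight by a linear functional. -/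
theorem integral_linear_smul_graph_eq_zero {h : K × ℝ → ℂ} (hd : ContDiff ℝ 1 h)
    (hs : HasCompactSupport h) {δ lo hi b₁ : ℝ} (hb₁ : b₁ ∈ Ioo lo hi)
    (hside : ∀ a ∈ Metric.ball (0 : StrongDual ℝ K) δ, ∀ y, h (y, b₁ + a y) = 0)
    {w : K → ℝ} (hw : Continuous w)
    (hzero : ∀ a ∈ Metric.ball (0 : StrongDual ℝ K) δ, ∀ b ∈ Ioo lo hi,
      ∫ y, w y • h (y, b + a y) ∂μ = 0)
    (l : StrongDual ℝ K) {a : StrongDual ℝ K} (ha : a ∈ Metric.ball (0 : StrongDual ℝ K) δ)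
    {b : ℝ} (hb : b ∈ Ioo lo hi) :
    ∫ y, (l y * w y) • h (y, b + a y) ∂μ = 0 := by
  -- The `b`-derivative with weight `l * w` equals the derivative at `s = 0` along `a + s • l` with
  -- weight `w`. The latter is zero because the ball of slopes is open.
  have hderiv : ∀ b ∈ Ioo lo hi,
      HasDerivAt (fun b => ∫ y, (l y * w y) • h (y, b + a y) ∂μ) 0 b := by
    intro b hb
    have h1 := hasDerivAt_integral_smul_graph (μ := μ) hd hs (w := fun y => l y * w y) (α := a)
      (β := fun _ => 1) (by fun_prop) (by fun_prop) continuous_const b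
    have h2 := hasDerivAt_integral_smul_graph (μ := μ) hd hs hw (α := fun y => b + a y) (β := l)
      (by fun_prop) (by fun_prop) 0
    have h3 : (fun s : ℝ => ∫ y, w y • h (y, b + a y + s * l y) ∂μ) =ᶠ[𝓝 0] fun _ => 0 := by
      have hcont : Continuous fun s : ℝ => a + s • l := by fun_prop
      have : ∀ᶠ s : ℝ in 𝓝 0, a + s • l ∈ Metric.ball (0 : StrongDual ℝ K) δ :=
        hcont.continuousAt.eventually_mem (Metric.isOpen_ball.mem_nhds (by simpa using ha))
      filter_upwards [this] with s hs
      simpa [add_assoc] using hzero _ hs b hb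
    have h4 := h2.unique (h3.hasDerivAt_iff.2 (hasDerivAt_const _ _))
    simp only [mul_one, zero_mul, add_zero] at h1 h4
    simp only [add_comm (a _)] at h1
    simpa only [mul_comm (l _), h4] using h1
  have hconst := isOpen_Ioo.is_const_of_deriv_eq_zero isPreconnected_Ioo
    (fun b hb => (hderiv b hb).differentiableAt.differentiableWithinAt)
    (fun b hb => (hderiv b hb).deriv) hb hb₁
  rw [hconst]
  simp [hside a ha]

/-- If the integrals of `h` over all graphs close to `K × {b}`, `b ∈ (lo, hi)`, vanish and `h`
vanishes on those through height `b₁`, then `h` vanishes on `K × (lo, hi)`. -/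
theorem eq_zero_of_integral_graph_eq_zero [FiniteDimensional ℝ K] [μ.IsOpenPosMeasure] {h : K × ℝ → ℂ}
    (hd : ContDiff ℝ 1 h) (hs : HasCompactSupport h) {δ lo hi b₁ : ℝ} (hδ : 0 < δ)
    (hb₁ : b₁ ∈ Ioo lo hi)
    (hside : ∀ a ∈ Metric.ball (0 : StrongDual ℝ K) δ, ∀ y, h (y, b₁ + a y) = 0)
    (hzero : ∀ a ∈ Metric.ball (0 : StrongDual ℝ K) δ, ∀ b ∈ Ioo lo hi,
      ∫ y, h (y, b + a y) ∂μ = 0) {b : ℝ} (hb : b ∈ Ioo lo hi) (y : K) : h (y, b) = 0 := by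
  have hc : Continuous h := hd.continuous
  let A : Subalgebra ℝ C(K, ℝ) :=
    Algebra.adjoin ℝ (range fun l : StrongDual ℝ K => (⟨l, l.continuous⟩ : C(K, ℝ)))
  have hA : A.SeparatesPoints := by
    intro x y hxy
    obtain ⟨l, hl⟩ := SeparatingDual.exists_separating_of_ne (R := ℝ) hxy
    exact ⟨l, ⟨_, Algebra.subset_adjoin (mem_range_self l), rfl⟩, hl⟩
  -- All slopes and heights are kept in `Q`: multiplying by one more functional uses a neighbourhood
  -- of slopes and an interval of heights.
  let Q : C(K, ℝ) → Prop := fun w => ∀ a ∈ Metric.ball (0 : StrongDual ℝ K) δ, ∀ b ∈ Ioo lo hi,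
    ∫ y, w y • h (y, b + a y) ∂μ = 0
  have hQ : ∀ m ∈ A, ∀ w, Q w → Q (m * w) := by
    intro m hm
    induction hm using Algebra.adjoin_induction with
    | mem m hm =>
      obtain ⟨l, rfl⟩ := hm
      intro w hw a ha b hb
      exact integral_linear_smul_graph_eq_zero hd hs hb₁ hside w.continuous hw l ha hb
    | algebraMap r =>
      intro w hw a ha b hb
      have e : ∀ y, (algebraMap ℝ C(K, ℝ) r * w) y • h (y, b + a y) =
          r • w y • h (y, b + a y) := fun y => by
        simp [algebraMap_apply, mul_smul]
      simp only [e, integral_smul, hw a ha b hb, smul_zero]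
    | add m₁ m₂ _ _ h₁ h₂ =>
      intro w hw a ha b hb
      have e : ∀ y, ((m₁ + m₂) * w) y • h (y, b + a y) =
          (m₁ * w) y • h (y, b + a y) + (m₂ * w) y • h (y, b + a y) := fun y => by
        simp [add_mul]
      simp only [e]
      rw [integral_add (integrable_smul_graph hc hs (m₁ * w).continuous (by fun_prop))
        (integrable_smul_graph hc hs (m₂ * w).continuous (by fun_prop)), h₁ w hw a ha b hb,
        h₂ w hw a ha b hb, add_zero]
    | mul m₁ m₂ _ _ h₁ h₂ =>
      intro w hw
      rw [mul_assoc]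
      exact h₁ _ (h₂ _ hw)
  have hpoly : ∀ m ∈ A, ∫ y, m y • h (y, b) ∂μ = 0 := by
    intro m hm
    have := hQ m hm 1 (fun a ha b hb => by simpa using hzero a ha b hb) 0 (by simpa using hδ) b hb
    simpa using this
  have hint : ∀ m : C(K, ℝ), Integrable (fun y => m y • h (y, b)) μ := fun m =>
    integrable_smul_graph hc hs m.continuous continuous_const
  -- Polynomials approximate `m` uniformly on the compact projection of the support. The `+ 1` in `ε
  -- / (J + 1)` covers `J = 0`.
  have hcont : ∀ m : C(K, ℝ), ∫ y, m y • h (y, b) ∂μ = 0 := by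
    intro m
    have hI : Integrable (fun y => h (y, b)) μ := by simpa using hint 1
    refine norm_le_zero_iff.1 (le_of_forall_gt_imp_ge_of_dense fun ε hε => ?_)
    set J := ∫ y, ‖h (y, b)‖ ∂μ
    have hJ : 0 ≤ J := integral_nonneg fun _ => norm_nonneg _
    obtain ⟨g, hg, hgm⟩ :=
      ContinuousMap.exists_mem_subalgebra_near_continuous_of_isCompact_of_separatesPoints hA m
        (hs.isCompact.image continuous_fst) (ε := ε / (J + 1)) (by positivity)
    rw [← norm_neg, ← zero_sub, ← hpoly g hg, ← integral_sub (hint g) (hint m)]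
    calc ‖∫ y, (g y • h (y, b) - m y • h (y, b)) ∂μ‖
        ≤ ∫ y, ε / (J + 1) * ‖h (y, b)‖ ∂μ := by
          refine norm_integral_le_of_norm_le (hI.norm.const_mul _) (.of_forall fun y => ?_)
          rw [← sub_smul, norm_smul]
          by_cases hy : y ∈ Prod.fst '' tsupport h
          · exact mul_le_mul_of_nonneg_right (hgm y hy).le (norm_nonneg _)
          · simp [eq_zero_of_notMem_fst_image_tsupport hy]
      _ = ε / (J + 1) * J := integral_const_mul _ _
      _ ≤ ε := by
          rw [div_mul_eq_mul_div, div_le_iff₀ (by positivity)]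
          nlinarith
  have hslice : Continuous fun y => h (y, b) := by fun_prop
  have hae : ∀ᵐ y ∂μ, h (y, b) = 0 :=
    ae_eq_zero_of_integral_contDiff_smul_eq_zero
      hslice.locallyIntegrable fun g hg _ => hcont ⟨g, hg.continuous⟩
  exact congrFun (Continuous.ae_eq_iff_eq μ hslice continuous_const |>.1 hae) y

end GraphMoments

/-! ### Reparametrizing the hyperplane integral. -/

theorem integral_ker_add_eq_zero_of_radonM_eq_zero {n : ℕ} {f : RSpace n → ℂ} {ξ : RDual n}
    (hξ : ξ ≠ 0) (h : radonM f ξ = 0) {q : RSpace n} (hq : ξ q = 1) :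
    ∫ z : ξ.ker, f (q + z) = 0 := by
  have hemb : MeasurableEmbedding fun y : ξ.ker => hyperplaneBase ξ 1 + (y : RSpace n) :=
    ((Homeomorph.addLeft (hyperplaneBase ξ 1)).isClosedEmbedding.comp
      ξ.isClosed_ker.isClosedEmbedding_subtypeVal).measurableEmbedding
  rw [radonM, hyperplaneMeasure, integral_smul_measure, hemb.integral_map] at h
  have hc : (ENNReal.ofReal ‖ξ‖⁻¹).toReal ≠ 0 := by
    rw [ENNReal.toReal_ofReal (by positivity)]
    simpa using hξ
  have h' := (smul_eq_zero.1 h).resolve_left hc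
  have hbase : ξ (hyperplaneBase ξ 1) = 1 := by
    have hv : ξ ((InnerProductSpace.toDual ℝ (RSpace n)).symm ξ) = ‖ξ‖ ^ 2 := by
      rw [← InnerProductSpace.toDual_symm_apply (𝕜 := ℝ), real_inner_self_eq_norm_sq]
      simp
    have hn : ‖ξ‖ ≠ 0 := by simpa using hξ
    simp [hyperplaneBase, hv, hn]
  let c : ξ.ker := ⟨q - hyperplaneBase ξ 1, by simp [hq, hbase]⟩
  rw [← integral_add_right_eq_self _ c] at h'
  rw [← h']
  congr 1
  ext z
  congr 1
  simp only [c, Submodule.coe_add]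
  abel

/-- Haar measures are proportional. Only vanishing is at stake, so no Jacobian is needed. -/
theorem integral_comp_continuousLinearEquiv_eq_zero {K L : Type*}
    [NormedAddCommGroup K] [InnerProductSpace ℝ K] [FiniteDimensional ℝ K] [MeasurableSpace K]
    [BorelSpace K] [NormedAddCommGroup L] [InnerProductSpace ℝ L] [FiniteDimensional ℝ L]
    [MeasurableSpace L] [BorelSpace L] (e : K ≃L[ℝ] L) {F : L → ℂ} (hF : ∫ z, F z = 0) :
    ∫ y, F (e y) = 0 := by
  have : (Measure.map e (volume : Measure K)).IsAddHaarMeasure :=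
    e.isAddHaarMeasure_map volume
  have h := Measure.isAddLeftInvariant_eq_smul (Measure.map e (volume : Measure K)) volume
  have hmap : ∫ z, F z ∂(Measure.map e (volume : Measure K)) = ∫ y, F (e y) :=
    e.toHomeomorph.measurableEmbedding.integral_map F
  rw [← hmap, h, integral_smul_nnreal_measure, hF, smul_zero]

/-! ### Hyperplanes near `ξ₀ = 1` as graphs over `ker ξ₀`. -/

section Tilt

variable {n : ℕ} (ξ₀ : RDual n) {p : RSpace n} (hp : ξ₀ p = 1)

/-- The projection onto the kernel of `ξ₀` along `p`. -/
noncomputable def kerProj : RSpace n →L[ℝ] ξ₀.ker :=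
  (ContinuousLinearMap.id ℝ (RSpace n) - ξ₀.smulRight p).codRestrict ξ₀.ker
    fun x => by simp [hp]

theorem kerProj_coe (x : RSpace n) : (kerProj ξ₀ hp x : RSpace n) = x - ξ₀ x • p := rfl

/-- The functional whose hyperplane at height one is the graph `{y + (b + a y) • p}` over
`ker ξ₀`. -/
noncomputable def tilt (a : StrongDual ℝ ξ₀.ker) (b : ℝ) : RDual n :=
  b⁻¹ • (ξ₀ - a.comp (kerProj ξ₀ hp))

theorem kerProj_add_smul (y : ξ₀.ker) (t : ℝ) :
    kerProj ξ₀ hp ((y : RSpace n) + t • p) = y := by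
  have hy : ξ₀ (y : RSpace n) = 0 := y.2
  ext1
  simp [kerProj_coe, hy, hp]

theorem apply_coe_ker_add_smul {ξ₀ : RDual n} {p : RSpace n} (hp : ξ₀ p = 1) (y : ξ₀.ker) (t : ℝ) : ξ₀ ((y : RSpace n) + t • p) = t := by
  have hy : ξ₀ (y : RSpace n) = 0 := y.2
  simp [hy, hp]

theorem tilt_apply_add_smul (a : StrongDual ℝ ξ₀.ker) (b : ℝ) (y : ξ₀.ker) (t : ℝ) :
    tilt ξ₀ hp a b ((y : RSpace n) + t • p) = b⁻¹ * (t - a y) := by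
  rw [tilt, smul_apply, sub_apply,
    ContinuousLinearMap.comp_apply, kerProj_add_smul, apply_coe_ker_add_smul hp, smul_eq_mul]

/-- The kernel of a tilted functional is a graph over `ker ξ₀`. -/
noncomputable def kerTiltEquiv (a : StrongDual ℝ ξ₀.ker) {b : ℝ} (hb : b ≠ 0) :
    ξ₀.ker ≃L[ℝ] (tilt ξ₀ hp a b).ker :=
  LinearEquiv.toContinuousLinearEquiv
    { toFun := fun y => ⟨(y : RSpace n) + a y • p, by
        simpa using tilt_apply_add_smul ξ₀ hp a b y (a y)⟩
      map_add' := fun y z => by ext1; simp [add_smul]; abel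
      map_smul' := fun c y => by ext1; simp [mul_smul]
      invFun := fun x => kerProj ξ₀ hp x
      left_inv := fun y => kerProj_add_smul ξ₀ hp y (a y)
      right_inv := fun x => by
        have hx : tilt ξ₀ hp a b (x : RSpace n) = 0 := x.2
        have h1 : ξ₀ (x : RSpace n) = a (kerProj ξ₀ hp x) := by
          simpa [tilt, hb, sub_eq_zero] using hx
        ext1
        simp [← h1, kerProj_coe] }

theorem integral_graph_eq_zero_of_radonM_tilt_eq_zero {f : RSpace n → ℂ}
    {a : StrongDual ℝ ξ₀.ker} {b : ℝ} (hb : b ≠ 0) (h : radonM f (tilt ξ₀ hp a b) = 0) :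
    ∫ y : ξ₀.ker, f ((y : RSpace n) + (b + a y) • p) = 0 := by
  have hq : tilt ξ₀ hp a b (b • p) = 1 := by
    simpa [hb] using tilt_apply_add_smul ξ₀ hp a b 0 b
  have hne : tilt ξ₀ hp a b ≠ 0 := fun h0 => by simp [h0] at hq
  have h1 := integral_comp_continuousLinearEquiv_eq_zero (kerTiltEquiv ξ₀ hp a hb)
    (integral_ker_add_eq_zero_of_radonM_eq_zero hne h hq)
  rw [← h1]
  congr 1
  ext y
  congr 1
  change (y : RSpace n) + (b + a y) • p = b • p + ((y : RSpace n) + a y • p)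
  rw [add_smul]
  abel

theorem tendsto_tilt :
    Tendsto (fun q : StrongDual ℝ ξ₀.ker × ℝ => tilt ξ₀ hp q.1 q.2) (𝓝 (0, 1)) (𝓝 ξ₀) := by
  have h : ContinuousAt (fun q : StrongDual ℝ ξ₀.ker × ℝ => tilt ξ₀ hp q.1 q.2) (0, 1) := by
    unfold tilt
    refine ContinuousAt.smul (continuousAt_snd.inv₀ one_ne_zero) ?_
    exact (continuous_const.sub (continuous_fst.clm_comp continuous_const)).continuousAt
  simpa [ContinuousAt, tilt] using h

end Tilt

/-! ### The local support theorem. -/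

/-- The function `(y, t) ↦ f (y + t • p)` on `ker ξ₀ × ℝ`, cut off near `t ≤ 0`. -/
noncomputable def cutoffGraph {n : ℕ} (f : RSpace n → ℂ) (ξ₀ : RDual n) (p : RSpace n)
    (q : ξ₀.ker × ℝ) : ℂ :=
  Real.smoothTransition (4 * q.2 - 1) • f ((q.1 : RSpace n) + q.2 • p)

theorem cutoffGraph_of_le {n : ℕ} (f : RSpace n → ℂ) (ξ₀ : RDual n) (p : RSpace n)
    {q : ξ₀.ker × ℝ} (hq : q.2 ≤ 1 / 4) : cutoffGraph f ξ₀ p q = 0 := by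
  rw [cutoffGraph, Real.smoothTransition.zero_of_nonpos (by linarith), zero_smul]

theorem cutoffGraph_of_ge {n : ℕ} (f : RSpace n → ℂ) (ξ₀ : RDual n) (p : RSpace n)
    {q : ξ₀.ker × ℝ} (hq : 1 / 2 ≤ q.2) :
    cutoffGraph f ξ₀ p q = f ((q.1 : RSpace n) + q.2 • p) := by
  rw [cutoffGraph, Real.smoothTransition.one_of_one_le (by linarith), one_smul]

namespace IsSmoothBoundedSupport

variable {n : ℕ} {f : RSpace n → ℂ}

theorem exists_norm_le (hf : IsSmoothBoundedSupport f) :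
    ∃ R : ℝ, 0 ≤ R ∧ ∀ x, x ≠ 0 → f x ≠ 0 → ‖x‖ ≤ R := by
  obtain ⟨R, hR⟩ := hf.bounded.exists_norm_le
  exact ⟨max R 0, le_max_right _ _, fun x hx hfx => (hR x ⟨hx, hfx⟩).trans (le_max_left _ _)⟩

theorem contDiff_cutoffGraph (hf : IsSmoothBoundedSupport f) {ξ₀ : RDual n} {p : RSpace n}
    (hp : ξ₀ p = 1) : ContDiff ℝ ∞ (cutoffGraph f ξ₀ p) := by
  rw [contDiff_iff_contDiffAt]
  rintro ⟨y, t⟩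
  rcases lt_or_ge t (1 / 4) with ht | ht
  · have h : cutoffGraph f ξ₀ p =ᶠ[𝓝 (y, t)] fun _ => 0 := by
      filter_upwards [continuous_snd.continuousAt.eventually_lt_const ht] with q hq
      exact cutoffGraph_of_le f ξ₀ p hq.le
    exact contDiffAt_const.congr_of_eventuallyEq h
  · have hx : (y : RSpace n) + t • p ≠ 0 := fun h0 => by
      have := apply_coe_ker_add_smul hp y t
      rw [h0, map_zero] at this
      linarith
    have hfx : ContDiffAt ℝ ∞ f ((y : RSpace n) + t • p) :=
      hf.smooth.contDiffAt (isOpen_compl_singleton.mem_nhds hx)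
    have hlin : ContDiffAt ℝ ∞ (fun q : ξ₀.ker × ℝ => (q.1 : RSpace n) + q.2 • p) (y, t) :=
      ((ξ₀.ker.subtypeL.contDiff.comp contDiff_fst).add
        (contDiff_snd.smul contDiff_const)).contDiffAt
    have hψ : ContDiffAt ℝ ∞ (fun q : ξ₀.ker × ℝ => Real.smoothTransition (4 * q.2 - 1)) (y, t) :=
      (Real.smoothTransition.contDiff.comp
        ((contDiff_const.mul contDiff_snd).sub contDiff_const)).contDiffAt
    exact hψ.smul (hfx.comp (y, t) hlin)

/-- The cutoff forces `t > 1 / 4` on the support, so `y + t • p ≠ 0` and the bound on `supp f`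
controls both coordinates. -/
theorem hasCompactSupport_cutoffGraph (hf : IsSmoothBoundedSupport f) {ξ₀ : RDual n}
    {p : RSpace n} (hp : ξ₀ p = 1) : HasCompactSupport (cutoffGraph f ξ₀ p) := by
  obtain ⟨R, hR0, hR⟩ := hf.exists_norm_le
  refine HasCompactSupport.intro ((isCompact_closedBall (0 : ξ₀.ker) (‖kerProj ξ₀ hp‖ * R)).prod
    (isCompact_closedBall (0 : ℝ) (‖ξ₀‖ * R))) ?_
  rintro ⟨y, t⟩ hq
  by_contra hne
  have ht : 1 / 4 < t := by
    by_contra! ht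
    exact hne (cutoffGraph_of_le f ξ₀ p ht)
  have hfx : f ((y : RSpace n) + t • p) ≠ 0 := fun h0 => hne (by simp [cutoffGraph, h0])
  have hx : (y : RSpace n) + t • p ≠ 0 := fun h0 => by
    have := apply_coe_ker_add_smul hp y t
    rw [h0, map_zero] at this
    linarith
  have hxR := hR _ hx hfx
  refine hq ⟨?_, ?_⟩
  · rw [mem_closedBall_zero_iff]
    have := (kerProj ξ₀ hp).le_of_opNorm_le_of_le le_rfl hxR
    rwa [kerProj_add_smul] at this
  · rw [mem_closedBall_zero_iff]
    have := ξ₀.le_of_opNorm_le_of_le le_rfl hxR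
    rwa [apply_coe_ker_add_smul hp] at this

/-- If `f` lives on one side of a hyperplane and its Radon transform vanishes on all nearby
hyperplanes, then `f` vanishes near that hyperplane. -/
theorem exists_forall_eq_zero_of_radonM_eventually_eq_zero (hf : IsSmoothBoundedSupport f)
    {ξ₀ : RDual n} (hξ₀ : ξ₀ ≠ 0) (hle : ∀ x, x ≠ 0 → f x ≠ 0 → ξ₀ x ≤ 1)
    (hM : ∀ᶠ ξ in 𝓝 ξ₀, radonM f ξ = 0) : ∃ ε > 0, ∀ x, |ξ₀ x - 1| < ε → f x = 0 := by
  obtain ⟨p, hp⟩ : ∃ p, ξ₀ p = 1 := by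
    obtain ⟨v, hv⟩ : ∃ v, ξ₀ v ≠ 0 := by
      by_contra! h
      exact hξ₀ (ContinuousLinearMap.ext h)
    exact ⟨(ξ₀ v)⁻¹ • v, by simp [hv]⟩
  obtain ⟨R, hR0, hR⟩ := hf.exists_norm_le
  obtain ⟨δ₀, hδ₀, hball⟩ := (Metric.eventually_nhds_iff (α := StrongDual ℝ ξ₀.ker × ℝ)).1
    ((tendsto_tilt ξ₀ hp).eventually hM)
  set R' := ‖kerProj ξ₀ hp‖ * R + 1
  have hR'0 : 0 < R' := by positivity
  set ε := min δ₀ (1 / 4)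
  have hε : 0 < ε := lt_min hδ₀ (by norm_num)
  have hε4 : ε ≤ 1 / 4 := min_le_right _ _
  set δ := min δ₀ (ε / (2 * R'))
  have hδ : 0 < δ := lt_min hδ₀ (by positivity)
  -- Where `f` is nonzero, `y` is bounded by `R'`, and `δ` is chosen so that a graph tilts by at
  -- most `ε / 2` there.
  have hsmall : ∀ a ∈ Metric.ball (0 : StrongDual ℝ ξ₀.ker) δ, ∀ (y : ξ₀.ker) (t : ℝ),
      (y : RSpace n) + t • p ≠ 0 → f ((y : RSpace n) + t • p) ≠ 0 → |a y| ≤ ε / 2 := by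
    intro a ha y t hx hfx
    have ha' : ‖a‖ < δ :=
      (dist_zero_right (E := StrongDual ℝ ξ₀.ker) a).symm.trans_lt ha
    have hy := (kerProj ξ₀ hp).le_of_opNorm_le_of_le le_rfl (hR _ hx hfx)
    rw [kerProj_add_smul] at hy
    calc |a y| ≤ (ε / (2 * R')) * R' :=
          a.le_of_opNorm_le_of_le (ha'.le.trans (min_le_right _ _)) (by linarith)
      _ = ε / 2 := by field_simp
  -- The value of `f` at the origin is arbitrary; a graph through the origin would have `y = 0`,
  -- hence height `b > 0` there.
  have hne : ∀ (a : StrongDual ℝ ξ₀.ker) {b : ℝ}, 0 < b → ∀ y : ξ₀.ker,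
      (y : RSpace n) + (b + a y) • p ≠ 0 := by
    intro a b hb y h0
    have h1 := apply_coe_ker_add_smul hp y (b + a y)
    have h2 := kerProj_add_smul ξ₀ hp y (b + a y)
    rw [h0, map_zero] at h1 h2
    rw [← h2, map_zero] at h1
    linarith
  have key : ∀ b ∈ Ioo (1 - ε) (1 + ε), ∀ y : ξ₀.ker, cutoffGraph f ξ₀ p (y, b) = 0 := by
    intro b hb y
    -- The height `1 + 3 / 4 * ε` lies below `1 + ε`, yet exceeds `1` even after a tilt of `ε / 2`,
    -- so its graphs miss the support.
    refine eq_zero_of_integral_graph_eq_zero (μ := volume) (δ := δ) (b₁ := 1 + 3 / 4 * ε)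
      ((hf.contDiff_cutoffGraph hp).of_le (by exact_mod_cast le_top))
      (hf.hasCompactSupport_cutoffGraph hp) hδ
      ⟨by linarith, by linarith⟩ ?_ ?_ hb y
    · intro a ha y
      by_contra hne0
      have hfx : f ((y : RSpace n) + (1 + 3 / 4 * ε + a y) • p) ≠ 0 :=
        fun h0 => hne0 (by simp only [cutoffGraph, h0, smul_zero])
      have hx := hne a (b := 1 + 3 / 4 * ε) (by linarith) y
      have h1 := hle _ hx hfx
      rw [apply_coe_ker_add_smul hp] at h1
      have h2 := (abs_le.1 (hsmall a ha y _ hx hfx)).1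
      linarith
    · intro a ha b hb
      rw [← integral_graph_eq_zero_of_radonM_tilt_eq_zero ξ₀ hp (f := f) (a := a) (b := b)
        (by linarith [hb.1] : 0 < b).ne' ?_]
      · congr 1
        ext y
        -- Where `f` is nonzero, the height is at least `1 - 3 / 2 * ε ≥ 5 / 8`, so the cutoff is
        -- `1`.
        by_cases hfx : f ((y : RSpace n) + (b + a y) • p) = 0
        · simp only [cutoffGraph, hfx, smul_zero]
        · have h2 := hsmall a ha y _ (hne a (by linarith [hb.1]) y) hfx
          exact cutoffGraph_of_ge f ξ₀ p (by linarith [(abs_le.1 h2).1, hb.1])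
      · refine hball (y := (a, b)) ?_
        rw [Prod.dist_eq, max_lt_iff]
        refine ⟨(Metric.mem_ball.1 ha).trans_le (min_le_left _ _), ?_⟩
        rw [Real.dist_eq, abs_lt]
        have := min_le_left δ₀ (1 / 4)
        exact ⟨by linarith [hb.1], by linarith [hb.2]⟩
  refine ⟨ε, hε, fun x hx => ?_⟩
  rw [abs_lt] at hx
  have h := key (ξ₀ x) ⟨by linarith, by linarith⟩ (kerProj ξ₀ hp x)
  rw [cutoffGraph_of_ge f ξ₀ p (show 1 / 2 ≤ ξ₀ x by linarith)] at h
  simpa [kerProj_coe] using h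

end IsSmoothBoundedSupport

/-! ### The polar set and the component of `0`. -/

theorem puncturedSupport_union_zero {V : Type*} [TopologicalSpace V] [Zero V] (g : V → ℂ) :
    puncturedSupport g ∪ {0} = closure {x : V | x ≠ 0 ∧ g x ≠ 0} ∪ {0} :=
  sdiff_union_self

theorem polarDual_convexHull {n : ℕ} {S : Set (RSpace n)} (h0 : (0 : RSpace n) ∈ S) :
    polarDual (convexHull ℝ S) = {ξ : RDual n | ∀ x ∈ S, ξ x < 1} := by
  rw [polarDual_eq (convex_convexHull ℝ S) (subset_convexHull ℝ S h0)]
  ext ξ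
  exact (convex_halfSpace_lt (f := ξ) ξ.isLinear 1).convexHull_subset_iff

/-- Compactness makes the strict inequality stable, uniformly over `S`, under small changes of `ξ`.
-/
theorem isOpen_setOf_forall_mem_lt_one {n : ℕ} {S : Set (RSpace n)} (hS : IsCompact S) :
    IsOpen {ξ : RDual n | ∀ x ∈ S, ξ x < 1} := by
  rw [isOpen_iff_mem_nhds]
  intro ξ hξ
  refine hS.eventually_forall_of_forall_eventually fun x hx => ?_
  exact (isBoundedBilinearMap_apply.continuous.continuousAt (x := (ξ, x))).eventually_lt_const
    (hξ x hx)

theorem convex_setOf_forall_mem_lt_one {n : ℕ} (S : Set (RSpace n)) :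
    Convex ℝ {ξ : RDual n | ∀ x ∈ S, ξ x < 1} := by
  intro ξ hξ η hη a b ha hb hab x hx
  exact convex_Iio (1 : ℝ) (hξ x hx) (hη x hx) ha hb hab

theorem radonM_eq_zero_of_forall {n : ℕ} {f : RSpace n → ℂ} {ξ : RDual n} (hξ : ξ ≠ 0)
    (h : ∀ x, ξ x = 1 → f x = 0) : radonM f ξ = 0 := by
  refine integral_eq_zero_of_ae ?_
  have h1 : ∀ᵐ x ∂(hyperplaneMeasure ξ 1), ξ x = 1 := hyperplaneMeasure_compl hξ 1
  filter_upwards [h1] with x hx using h x hx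

/-- For `f` smooth with bounded support on `ℝⁿ ∖ {0}`, the connected component containing `0` of
`(ℝⁿ)* ∖ supp (M f)` is the dual of the convex hull of `supp f ∪ {0}`; in particular it is
convex. -/
theorem proposition4p6 (n : ℕ) (hn : 2 ≤ n) (f : RSpace n → ℂ) (hf : IsSmoothBoundedSupport f) :
    connectedComponentIn (puncturedSupport (radonM f))ᶜ 0 =
        polarDual (convexHull ℝ (puncturedSupport f ∪ {0})) ∧
      Convex ℝ (connectedComponentIn (puncturedSupport (radonM f))ᶜ 0) := by
  set S : Set (RSpace n) := closure {x | x ≠ 0 ∧ f x ≠ 0} ∪ {0}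
  set T : Set (RDual n) := {ξ | ξ ≠ 0 ∧ radonM f ξ ≠ 0}
  set V : Set (RDual n) := {ξ | ∀ x ∈ S, ξ x < 1}
  have hS : IsCompact S := hf.bounded.isCompact_closure.union isCompact_singleton
  have hVpolar : polarDual (convexHull ℝ (puncturedSupport f ∪ {0})) = V := by
    rw [puncturedSupport_union_zero, polarDual_convexHull (Or.inr rfl)]
  have hVopen : IsOpen V := isOpen_setOf_forall_mem_lt_one hS
  have hVconvex : Convex ℝ V := convex_setOf_forall_mem_lt_one S
  have h0V : (0 : RDual n) ∈ V := fun x _ => by simp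
  have hVM : ∀ ξ ∈ V, ξ ∉ T := by
    rintro ξ hξ ⟨hξ0, hM⟩
    refine hM (radonM_eq_zero_of_forall hξ0 fun x hx => ?_)
    by_contra hfx
    have hx0 : x ≠ 0 := by rintro rfl; simp at hx
    exact (hξ x (Or.inl (subset_closure ⟨hx0, hfx⟩))).ne hx
  have hVsub : V ⊆ (puncturedSupport (radonM f))ᶜ := by
    rintro ξ hξ ⟨hcl, -⟩
    obtain ⟨η, hη, hηT⟩ := mem_closure_iff.1 hcl V hVopen hξ
    exact hVM η hη hηT
  suffices h : connectedComponentIn (puncturedSupport (radonM f))ᶜ 0 = V by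
    rw [hVpolar, h]
    exact ⟨rfl, hVconvex⟩
  refine Subset.antisymm ?_
    (hVconvex.isPreconnected.subset_connectedComponentIn h0V hVsub)
  -- A connected set meeting an open `V` stays in `V` if it contains no limit point of `V` outside
  -- `V`.
  refine isPreconnected_connectedComponentIn.subset_of_closure_inter_subset hVopen
    ⟨0, mem_connectedComponentIn (hVsub h0V), h0V⟩ ?_
  rintro ξ ⟨hξcl, hξU⟩
  have hξT : ξ ∉ puncturedSupport (radonM f) := connectedComponentIn_subset _ _ hξU
  by_cases hξ0 : ξ = 0
  · rwa [hξ0]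
  have hle : ∀ x ∈ S, ξ x ≤ 1 := by
    intro x hx
    have hclosed : IsClosed {η : RDual n | η x ≤ 1} :=
      isClosed_le (by fun_prop) continuous_const
    exact closure_minimal (fun η hη => (hη x hx).le) hclosed hξcl
  have hM : ∀ᶠ η in 𝓝 ξ, radonM f η = 0 := by
    have hnot : ξ ∉ closure T := fun h => hξT ⟨h, hξ0⟩
    filter_upwards [isClosed_closure.isOpen_compl.mem_nhds hnot,
      isOpen_compl_singleton.mem_nhds hξ0] with η hη hη0
    by_contra hne
    exact hη (subset_closure ⟨hη0, hne⟩)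
  obtain ⟨ε, hε, hzero⟩ := hf.exists_forall_eq_zero_of_radonM_eventually_eq_zero hξ0
    (fun x hx hfx => hle x (Or.inl (subset_closure ⟨hx, hfx⟩))) hM
  -- If `ξ x = 1`, then `x` is a limit of points where `f ≠ 0`, some of them inside the slab where
  -- `f` vanishes.
  intro x hx
  refine lt_of_le_of_ne (hle x hx) fun h1 => ?_
  rcases hx with hx | rfl
  · obtain ⟨z, hz, -, hfz⟩ := mem_closure_iff.1 hx {z | |ξ z - 1| < ε}
      (isOpen_lt (by fun_prop) continuous_const) (by simpa [h1] using hε)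
    exact hfz (hzero z hz)
  · simp at h1
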